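/- **Theorem 3.2.** Let $a<b$ be real numbers and let $f:(a,b)\times\mathbb R\to\mathbb R$ be an arbitrary function. For $v\in BV(a,b)$ write $Dv=D^av\,dx+D^sv$ for the Lebesgue decomposition of the distributional derivative of $v$ with respect to Lebesgue measure, $\frac{D^sv}{|D^sv|}$ for the density of $D^sv$ with respect to its total variation, and $v(a^+)$, $v(b^-)$ for the traces of $v$ at the endpoints. Let $u\in BV(a,b)$ be a bounded variation solution of $$-\left(\frac{u'}{\sqrt{1+(u')^2}}\right)'=f(x,u),\qquad a<x<b,$$ that is, $f(\cdot,u(\cdot))\in L^1(a,b)$ and $$\int_a^b\frac{D^au(x)\,D^a\phi(x)}{\sqrt{1+(D^au(x))^2}}\,dx+\int_a^b\frac{D^su}{|D^su|}(x)\,D^s\phi=\int_a^bf(x,u(x))\,\phi(x)\,dx$$ for all $\phi\in BV(a,b)$ such that $|D^s\phi|$ is absolutely continuous with respect to $|D^su|$ and $\phi(a^+)=\phi(b^-)=0$. Then the following assertions hold. (j) If $f(x,u(x))\ge 0$ for almost all $x\in(a,b)$ and there exist $\delta\in(0,b-a]$ and $\mu\in L^1(a,a+\delta)$ such that $f(x,u(x))\le\mu(x)$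 for almost all $x\in(a,a+\delta)$, $M(x):=\int_a^x\mu(t)\,dt>0$ for all $x\in(a,a+\delta]$, and $\int_a^{a+\delta}\frac{dx}{\sqrt{M(x)}}=+\infty$, then $u\in W^{2,1}_{\mathrm{loc}}[a,b)\cap W^{1,1}(a,b)$. (jj) If $f(x,u(x))\ge 0$ for almost all $x\in(a,b)$ and there exist $\delta\in(0,b-a]$ and $\mu\in L^1(b-\delta,b)$ such that $f(x,u(x))\le\mu(x)$ for almost all $x\in(b-\delta,b)$, $M(x):=\int_x^b\mu(t)\,dt>0$ for all $x\in[b-\delta,b)$, and $\int_{b-\delta}^b\frac{dx}{\sqrt{M(x)}}=+\infty$, then $u\in W^{2,1}_{\mathrm{loc}}(a,b]\cap W^{1,1}(a,b)$. (jjj) If $f(x,u(x))\le 0$ for almost all $x\in(a,b)$ and there exist $\delta\in(0,b-a]$ and $\nu\in L^1(a,a+\delta)$ such that $f(x,u(x))\ge\nu(x)$ for almost all $x\in(a,a+\delta)$, $N(x):=\int_a^x\nu(t)\,dt<0$ for all $x\in(a,a+\delta]$, and $\int_a^{a+\delta}\frac{dx}{\sqrt{-N(x)}}=+\infty$, then $u\in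 W^{2,1}_{\mathrm{loc}}[a,b)\cap W^{1,1}(a,b)$. (jjjj) If $f(x,u(x))\le 0$ for almost all $x\in(a,b)$ and there exist $\delta\in(0,b-a]$ and $\nu\in L^1(b-\delta,b)$ such that $f(x,u(x))\ge\nu(x)$ for almost all $x\in(b-\delta,b)$, $N(x):=\int_x^b\nu(t)\,dt<0$ for all $x\in[b-\delta,b)$, and $\int_{b-\delta}^b\frac{dx}{\sqrt{-N(x)}}=+\infty$, then $u\in W^{2,1}_{\mathrm{loc}}(a,b]\cap W^{1,1}(a,b)$. Here $u\in W^{2,1}_{\mathrm{loc}}[a,b)$ means $u\in W^{2,1}(a,c)$ for every $c\in(a,b)$, and $u\in W^{2,1}_{\mathrm{loc}}(a,b]$ means $u\in W^{2,1}(c,b)$ for every $c\in(a,b)$. -/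

import Mathlib

open Set Filter MeasureTheory Topology
open scoped ContDiff

namespace Curvature

/-- `θ` is a test function on `(a, b)`, that is, `θ ∈ C_c^∞(a, b)`. -/
structure IsTestFunction (a b : ℝ) (θ : ℝ → ℝ) : Prop where
  smooth : ContDiff ℝ ∞ θ
  compact : HasCompactSupport θ
  subset : tsupport θ ⊆ Ioo a b

/-- The finite signed measure `ν`, carried by `(a, b)`, is the distributional derivative `Du`
of `u` on `(a, b)`. It is determined by `u`. -/
structure IsDistribDeriv (a b : ℝ) (u : ℝ → ℝ) (ν : SignedMeasure ℝ) : Prop where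
  carried : ν.totalVariation (Ioo a b)ᶜ = 0
  by_parts : ∀ θ : ℝ → ℝ, IsTestFunction a b θ →
    ∫ x in Ioo a b, u x * deriv θ x = - ∫ᵛ x, θ x ∂•ν

/-- `g` is the weak derivative of `u` on `(a, b)` (used for integrable `u` and `g`). -/
def IsWeakDeriv (a b : ℝ) (u g : ℝ → ℝ) : Prop :=
  ∀ θ : ℝ → ℝ, IsTestFunction a b θ →
    ∫ x in Ioo a b, u x * deriv θ x = - ∫ x in Ioo a b, g x * θ x

/-- `u ∈ W^{1,1}(a, b)`. -/
def MemW11 (a b : ℝ) (u : ℝ → ℝ) : Prop :=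
  IntegrableOn u (Ioo a b) ∧ ∃ g : ℝ → ℝ, IntegrableOn g (Ioo a b) ∧ IsWeakDeriv a b u g

/-- `u ∈ W^{2,1}(a, b)`. -/
def MemW21 (a b : ℝ) (u : ℝ → ℝ) : Prop :=
  IntegrableOn u (Ioo a b) ∧ ∃ g h : ℝ → ℝ,
    IntegrableOn g (Ioo a b) ∧ IsWeakDeriv a b u g ∧
    IntegrableOn h (Ioo a b) ∧ IsWeakDeriv a b g h

/-- `u ∈ W^{2,1}_loc[a, b)`. -/
def MemW21LocIco (a b : ℝ) (u : ℝ → ℝ) : Prop :=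
  ∀ c ∈ Ioo a b, MemW21 a c u

/-- `u ∈ W^{2,1}_loc(a, b]`. -/
def MemW21LocIoc (a b : ℝ) (u : ℝ → ℝ) : Prop :=
  ∀ c ∈ Ioo a b, MemW21 c b u

/-- `v(x₀⁺) = l`: the right trace (essential right limit) of `v` at `x₀` is `l`. -/
def HasRightTrace (v : ℝ → ℝ) (x₀ l : ℝ) : Prop :=
  Tendsto v (𝓝[>] x₀ ⊓ ae volume) (𝓝 l)

/-- `v(x₀⁻) = l`: the left trace (essential left limit) of `v` at `x₀` is `l`. -/
def HasLeftTrace (v : ℝ → ℝ) (x₀ l : ℝ) : Prop :=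
  Tendsto v (𝓝[<] x₀ ⊓ ae volume) (𝓝 l)

/-- The density `D^a v` of the absolutely continuous part of `Dv = ν`. -/
noncomputable def acDensity (ν : SignedMeasure ℝ) : ℝ → ℝ := ν.rnDeriv volume

/-- The singular part `D^s v` of `Dv = ν` with respect to Lebesgue measure. -/
noncomputable def singPart (ν : SignedMeasure ℝ) : SignedMeasure ℝ := ν.singularPart volume

/-- The density `σ / |σ|` of a signed measure `σ` with respect to its total variation. -/
noncomputable def polarDensity (σ : SignedMeasure ℝ) : ℝ → ℝ := σ.rnDeriv σ.totalVariation

/-- `u` is a bounded variation solution on `(a, b)` of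
`-(u' / √(1 + (u')²))' = f(x, u)`. -/
def IsBVSolution (a b : ℝ) (f : ℝ → ℝ → ℝ) (u : ℝ → ℝ) : Prop :=
  IntegrableOn u (Ioo a b) ∧
  IntegrableOn (fun x => f x (u x)) (Ioo a b) ∧
  ∃ Du : SignedMeasure ℝ, IsDistribDeriv a b u Du ∧
    ∀ (φ : ℝ → ℝ) (Dφ : SignedMeasure ℝ),
      IntegrableOn φ (Ioo a b) → IsDistribDeriv a b φ Dφ →
      (singPart Dφ).totalVariation ≪ (singPart Du).totalVariation →
      HasRightTrace φ a 0 → HasLeftTrace φ b 0 →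
      (∫ x in Ioo a b, acDensity Du x * acDensity Dφ x / √(1 + acDensity Du x ^ 2))
        + ∫ᵛ x, polarDensity (singPart Du) x ∂•(singPart Dφ)
        = ∫ x in Ioo a b, f x (u x) * φ x

end Curvature

/-! Write `p x = k + ∫ t in x..b, f t (u t)`. Fix measurable `A`, `B` and test the equation with the
`φ` whose derivative is `|Dˢu|` on `A` plus Lebesgue measure on `B`, minus the multiple of Lebesgue
measure that makes `φ` vanish at `b`. After Fubini, since `A` and `B` are arbitrary, the flux `Dᵃu /
√(1 + (Dᵃu)²)` equals `p` Lebesgue-a.e. and `Dˢu / |Dˢu|` equals the same `p` `|Dˢu|`-a.e.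
(`IsBVSolution.test_identity`, `IsBVSolution.exists_profile`).

The flux has modulus `< 1`, so `|p| < 1` a.e.; since `f(·, u)` has a sign, `p` is monotone and `|p|
< 1` throughout `(a, b)` (`abs_flux_lt_one`). A polar density has modulus one, so `Dˢu = 0` and `u ∈
W^{1,1}` (`IsBVSolution.exists_weakDeriv`).

If `|p| ≥ 1` at the endpoint in question, then `1 - |p| ≤ M` nearby, so `|u'|` is at least of order
`1 / √M` and cannot be integrable (`lintegral_one_div_sqrt_ne_top`). Hence `|p|` stays below a
constant `< 1` up to that endpoint, and `u' = p / √(1 - p²)` is absolutely continuous there along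
with `p` (`memW21_of_flux`). -/

namespace Curvature

/-! ### Integrals against signed measures -/

section SignedIntegral

lemma integral_lsmul_toSignedMeasure (m : Measure ℝ) [IsFiniteMeasure m] (f : ℝ → ℝ) :
    m.toSignedMeasure.integral f (ContinuousLinearMap.lsmul ℝ ℝ) = ∫ x, f x ∂m := by
  rw [← VectorMeasure.integral_toSignedMeasure]
  congr 1
  ext
  simp

lemma integral_lsmul_toSignedMeasure_sub (m₁ m₂ : Measure ℝ) [IsFiniteMeasure m₁]
    [IsFiniteMeasure m₂] {f : ℝ → ℝ} (h₁ : Integrable f m₁) (h₂ : Integrable f m₂) :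
    (m₁.toSignedMeasure - m₂.toSignedMeasure).integral f (ContinuousLinearMap.lsmul ℝ ℝ)
      = ∫ x, f x ∂m₁ - ∫ x, f x ∂m₂ := by
  rw [VectorMeasure.integral_sub_vectorMeasure, integral_lsmul_toSignedMeasure,
    integral_lsmul_toSignedMeasure]
  · simpa [VectorMeasure.Integrable] using h₁
  · simpa [VectorMeasure.Integrable] using h₂

lemma integral_lsmul_withDensityᵥ {f g : ℝ → ℝ} (hf : Continuous f) (hfc : HasCompactSupport f)
    (hg : Integrable g) (hgm : Measurable g) :
    (volume.withDensityᵥ g).integral f (ContinuousLinearMap.lsmul ℝ ℝ) = ∫ x, g x * f x := by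
  have := isFiniteMeasure_withDensity_ofReal hg.2
  have := isFiniteMeasure_withDensity_ofReal hg.neg.2
  have : IsFiniteMeasure (volume.withDensity fun x => ENNReal.ofReal (-g x)) := this
  obtain ⟨C, hC⟩ := hfc.exists_bound_of_continuous hf
  have hint : ∀ m : Measure ℝ, IsFiniteMeasure m → Integrable f m := fun m _ =>
    Integrable.of_bound hf.aestronglyMeasurable C (ae_of_all _ hC)
  have hbd : ∀ k : ℝ → ℝ, Integrable k → Integrable (fun x => k x * f x) := fun k hk =>
    hk.mul_bdd (c := C) hf.aestronglyMeasurable (ae_of_all _ hC)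
  rw [withDensityᵥ_eq_withDensity_pos_part_sub_withDensity_neg_part hg,
    integral_lsmul_toSignedMeasure_sub _ _ (hint _ inferInstance) (hint _ inferInstance),
    integral_withDensity_eq_integral_toReal_smul (by fun_prop) (by simp),
    integral_withDensity_eq_integral_toReal_smul (by fun_prop) (by simp), ← integral_sub]
  · refine integral_congr_ae (ae_of_all _ fun x => ?_)
    simp only [smul_eq_mul, ← sub_mul, ENNReal.toReal_ofReal']
    congr 1
    rcases le_total 0 (g x) with h | h <;> simp [h]
  · simpa [ENNReal.toReal_ofReal'] using hbd _ hg.pos_part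
  · simpa [ENNReal.toReal_ofReal'] using hbd _ hg.neg_part

end SignedIntegral

/-! ### Primitives of measures as test functions of bounded variation -/

section Primitive

variable {a b : ℝ}

lemma ae_mem_Ioo_of_compl_null {m : Measure ℝ} (hm : m (Ioo a b)ᶜ = 0) :
    ∀ᵐ t ∂m, t ∈ Ioo a b := hm

/-- Fubini applied to `g x` on the region `t ≤ x`. It yields both the distributional derivative of a
primitive and the right-hand side of the tested equation. -/
lemma integral_mul_measureReal_Iic (m : Measure ℝ) [IsFiniteMeasure m]
    (hm : m (Ioo a b)ᶜ = 0) {g : ℝ → ℝ} (hg : IntegrableOn g (Ioo a b)) :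
    ∫ x in Ioo a b, g x * m.real (Iic x) = ∫ t, (∫ x in t..b, g x) ∂m := by
  have h1 : ∀ x, g x * m.real (Iic x) = ∫ t, (Iic x).indicator (fun _ => g x) t ∂m := by
    intro x
    rw [integral_indicator_const _ measurableSet_Iic]
    simp [mul_comm]
  simp_rw [h1]
  rw [integral_integral_swap]
  · refine integral_congr_ae ?_
    filter_upwards [ae_mem_Ioo_of_compl_null hm] with t ht
    have : ∀ x, (Iic x).indicator (fun _ => g x) t = (Ici t).indicator g x := by
      intro x; simp [indicator]
    simp_rw [this]
    rw [integral_indicator measurableSet_Ici, Measure.restrict_restrict measurableSet_Ici,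
      intervalIntegral.integral_of_le ht.2.le, integral_Ioc_eq_integral_Ioo,
      ← integral_Ico_eq_integral_Ioo]
    congr 2
    ext x
    simp only [mem_inter_iff, mem_Ici, mem_Ioo, mem_Ico]
    exact ⟨fun h => ⟨h.1, h.2.2⟩, fun h => ⟨h.1, ht.1.trans_le h.1, h.2⟩⟩
  · have h2 : Integrable (fun z : ℝ × ℝ => g z.1) ((volume.restrict (Ioo a b)).prod m) :=
      hg.comp_fst m
    have h3 : MeasurableSet {z : ℝ × ℝ | z.2 ≤ z.1} :=
      measurableSet_le measurable_snd measurable_fst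
    refine (h2.indicator h3).congr (ae_of_all _ fun z => ?_)
    simp [Function.uncurry, indicator]

lemma measurable_measureReal_Iic (m : Measure ℝ) [IsFiniteMeasure m] :
    Measurable fun x => m.real (Iic x) :=
  Monotone.measurable fun _ _ h => measureReal_mono (Iic_subset_Iic.2 h)

lemma norm_measureReal_Iic_le (m : Measure ℝ) [IsFiniteMeasure m] (x : ℝ) :
    ‖m.real (Iic x)‖ ≤ m.real univ := by
  rw [Real.norm_of_nonneg measureReal_nonneg]
  exact measureReal_mono (subset_univ _)

lemma tendsto_measureReal_Iic_right (m : Measure ℝ) [IsFiniteMeasure m]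
    (hm : m (Ioo a b)ᶜ = 0) : Tendsto (fun x => m.real (Iic x)) (𝓝[>] a) (𝓝 0) := by
  have h1 : ∀ x, m.real (Iic x) = ∫ t, (Iic x).indicator (fun _ => (1 : ℝ)) t ∂m := by
    intro x; rw [integral_indicator_const _ measurableSet_Iic]; simp
  simp_rw [h1]
  rw [← integral_zero ℝ ℝ (μ := m)]
  refine tendsto_integral_filter_of_dominated_convergence (fun _ => 1)
    (Eventually.of_forall fun x =>
      (measurable_const.indicator measurableSet_Iic).aestronglyMeasurable)
    (Eventually.of_forall fun x => ae_of_all _ fun t => ?_) (integrable_const _) ?_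
  · by_cases h : t ∈ Iic x <;> simp [h]
  · filter_upwards [ae_mem_Ioo_of_compl_null hm] with t ht
    refine tendsto_const_nhds.congr' ?_
    filter_upwards [mem_nhdsWithin_of_mem_nhds (Iio_mem_nhds ht.1)] with x hx
    rw [indicator_of_notMem (by simpa using hx)]

lemma tendsto_measureReal_Iic_left (m : Measure ℝ) [IsFiniteMeasure m]
    (hm : m (Ioo a b)ᶜ = 0) :
    Tendsto (fun x => m.real (Iic x)) (𝓝[<] b) (𝓝 (m.real univ)) := by
  have h1 : ∀ x, m.real (Iic x) = ∫ t, (Iic x).indicator (fun _ => (1 : ℝ)) t ∂m := by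
    intro x; rw [integral_indicator_const _ measurableSet_Iic]; simp
  have h2 : m.real univ = ∫ _, (1 : ℝ) ∂m := by simp
  simp_rw [h1, h2]
  refine tendsto_integral_filter_of_dominated_convergence (fun _ => 1)
    (Eventually.of_forall fun x =>
      (measurable_const.indicator measurableSet_Iic).aestronglyMeasurable)
    (Eventually.of_forall fun x => ae_of_all _ fun t => ?_) (integrable_const _) ?_
  · by_cases h : t ∈ Iic x <;> simp [h]
  · filter_upwards [ae_mem_Ioo_of_compl_null hm] with t ht
    refine tendsto_const_nhds.congr' ?_
    filter_upwards [mem_nhdsWithin_of_mem_nhds (Ioi_mem_nhds ht.2)] with x hx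
    rw [indicator_of_mem (by simpa using hx.le)]

lemma IsTestFunction.eq_zero {θ : ℝ → ℝ} (hθ : IsTestFunction a b θ) {x : ℝ}
    (hx : x ∉ Ioo a b) : θ x = 0 :=
  image_eq_zero_of_notMem_tsupport fun h => hx (hθ.subset h)

lemma IsTestFunction.deriv_eq_zero {θ : ℝ → ℝ} (hθ : IsTestFunction a b θ) {x : ℝ}
    (hx : x ∉ Ioo a b) : deriv θ x = 0 :=
  image_eq_zero_of_notMem_tsupport fun h => hx (hθ.subset (tsupport_deriv_subset h))

lemma IsTestFunction.continuous_deriv {θ : ℝ → ℝ} (hθ : IsTestFunction a b θ) :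
    Continuous (deriv θ) := hθ.smooth.continuous_deriv (by simp)

lemma IsTestFunction.differentiable {θ : ℝ → ℝ} (hθ : IsTestFunction a b θ) :
    Differentiable ℝ θ := hθ.smooth.differentiable (by simp)

lemma IsTestFunction.integrable {θ : ℝ → ℝ} (hθ : IsTestFunction a b θ) (m : Measure ℝ)
    [IsFiniteMeasure m] : Integrable θ m := by
  obtain ⟨C, hC⟩ := hθ.compact.exists_bound_of_continuous hθ.smooth.continuous
  exact Integrable.of_bound hθ.smooth.continuous.aestronglyMeasurable C (ae_of_all _ hC)

lemma IsTestFunction.integral_deriv {θ : ℝ → ℝ} (hθ : IsTestFunction a b θ) (t : ℝ) :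
    ∫ x in t..b, deriv θ x = - θ t := by
  rw [intervalIntegral.integral_deriv_eq_sub (fun x _ => hθ.differentiable x)
    (hθ.continuous_deriv.intervalIntegrable _ _), hθ.eq_zero (by simp), zero_sub]

lemma IsTestFunction.mono {θ : ℝ → ℝ} {c d : ℝ} (hθ : IsTestFunction c d θ)
    (h : Ioo c d ⊆ Ioo a b) : IsTestFunction a b θ :=
  ⟨hθ.smooth, hθ.compact, hθ.subset.trans h⟩

variable {m₁ m₂ : Measure ℝ} [IsFiniteMeasure m₁] [IsFiniteMeasure m₂]

lemma integrableOn_mul_measureReal_Iic (m : Measure ℝ) [IsFiniteMeasure m] {g : ℝ → ℝ}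
    (hg : IntegrableOn g (Ioo a b)) :
    IntegrableOn (fun x => g x * m.real (Iic x)) (Ioo a b) :=
  hg.mul_bdd (c := m.real univ) (measurable_measureReal_Iic m).aestronglyMeasurable
    (ae_of_all _ fun x => norm_measureReal_Iic_le m x)

lemma integral_mul_primitive_sub (h₁ : m₁ (Ioo a b)ᶜ = 0) (h₂ : m₂ (Ioo a b)ᶜ = 0)
    {g : ℝ → ℝ} (hg : IntegrableOn g (Ioo a b)) :
    ∫ x in Ioo a b, g x * (m₁.real (Iic x) - m₂.real (Iic x)) =
      ∫ t, (∫ x in t..b, g x) ∂m₁ - ∫ t, (∫ x in t..b, g x) ∂m₂ := by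
  rw [← integral_mul_measureReal_Iic m₁ h₁ hg, ← integral_mul_measureReal_Iic m₂ h₂ hg,
    ← integral_sub (integrableOn_mul_measureReal_Iic m₁ hg)
      (integrableOn_mul_measureReal_Iic m₂ hg)]
  simp_rw [mul_sub]

lemma totalVariation_toSignedMeasure_sub_le :
    (m₁.toSignedMeasure - m₂.toSignedMeasure).totalVariation ≤ m₁ + m₂ := by
  rw [SignedMeasure.totalVariation, Measure.toJordanDecomposition_toSignedMeasure_sub]
  exact add_le_add Measure.sub_le Measure.sub_le

/-- Fubini with `g = θ'`, whose integral from `t` to `b` is `-θ t`. -/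
lemma isDistribDeriv_primitive_sub (h₁ : m₁ (Ioo a b)ᶜ = 0) (h₂ : m₂ (Ioo a b)ᶜ = 0) :
    IsDistribDeriv a b (fun x => m₁.real (Iic x) - m₂.real (Iic x))
      (m₁.toSignedMeasure - m₂.toSignedMeasure) where
  carried := by
    refine le_antisymm ((totalVariation_toSignedMeasure_sub_le _).trans ?_) bot_le
    simp [h₁, h₂]
  by_parts θ hθ := by
    rw [integral_lsmul_toSignedMeasure_sub _ _ (hθ.integrable _) (hθ.integrable _)]
    simp_rw [mul_comm _ (deriv θ _)]
    rw [integral_mul_primitive_sub h₁ h₂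
      (hθ.continuous_deriv.integrableOn_Icc.mono_set Ioo_subset_Icc_self)]
    simp_rw [hθ.integral_deriv]
    rw [integral_neg, integral_neg]
    ring

lemma integrableOn_primitive_sub :
    IntegrableOn (fun x => m₁.real (Iic x) - m₂.real (Iic x)) (Ioo a b) := by
  have h := fun (m : Measure ℝ) [IsFiniteMeasure m] =>
    integrableOn_mul_measureReal_Iic (a := a) (b := b) m (g := fun _ => 1) (by simp)
  simpa [Pi.sub_def] using (h m₁).sub (h m₂)

lemma hasRightTrace_primitive_sub (h₁ : m₁ (Ioo a b)ᶜ = 0) (h₂ : m₂ (Ioo a b)ᶜ = 0) :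
    HasRightTrace (fun x => m₁.real (Iic x) - m₂.real (Iic x)) a 0 := by
  have := (tendsto_measureReal_Iic_right m₁ h₁).sub (tendsto_measureReal_Iic_right m₂ h₂)
  rw [sub_zero] at this
  exact this.mono_left inf_le_left

lemma hasLeftTrace_primitive_sub (h₁ : m₁ (Ioo a b)ᶜ = 0) (h₂ : m₂ (Ioo a b)ᶜ = 0)
    (h : m₁.real univ = m₂.real univ) :
    HasLeftTrace (fun x => m₁.real (Iic x) - m₂.real (Iic x)) b 0 := by
  have := (tendsto_measureReal_Iic_left m₁ h₁).sub (tendsto_measureReal_Iic_left m₂ h₂)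
  rw [h, sub_self] at this
  exact this.mono_left inf_le_left

end Primitive

/-! ### Lebesgue decomposition and polar density -/

section SingularPart

lemma singPart_totalVariation_le (ν : SignedMeasure ℝ) :
    (singPart ν).totalVariation ≤ ν.totalVariation := by
  rw [singPart, SignedMeasure.singularPart_totalVariation, SignedMeasure.totalVariation]
  exact add_le_add (Measure.singularPart_le _ _) (Measure.singularPart_le _ _)

lemma singPart_totalVariation_mutuallySingular (ν : SignedMeasure ℝ) :
    (singPart ν).totalVariation ⟂ₘ volume := by
  rw [singPart, SignedMeasure.singularPart_totalVariation]
  exact (Measure.mutuallySingular_singularPart _ _).add_left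
    (Measure.mutuallySingular_singularPart _ _)

lemma totalVariation_toSignedMeasure (m : Measure ℝ) [IsFiniteMeasure m] :
    m.toSignedMeasure.totalVariation = m := by
  rw [SignedMeasure.totalVariation_eq_variation, Measure.variation_toSignedMeasure]

/-- The density of a signed measure with respect to its total variation is unimodular. -/
lemma abs_polarDensity (σ : SignedMeasure ℝ) :
    ∀ᵐ x ∂σ.totalVariation, |polarDensity σ x| = 1 := by
  have hac : σ ≪ᵥ σ.totalVariation.toENNRealVectorMeasure := by
    refine VectorMeasure.AbsolutelyContinuous.mk fun s hs h => ?_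
    rw [Measure.toENNRealVectorMeasure_apply_measurable hs] at h
    exact σ.null_of_totalVariation_zero h
  have h := SignedMeasure.withDensityᵥ_rnDeriv_eq σ σ.totalVariation hac
  have hint := SignedMeasure.integrable_rnDeriv σ σ.totalVariation
  -- From `σ = h |σ|` follows `|σ| = |h| |σ|`; comparing the densities `1` and `|h|` gives `|h| = 1`
  -- a.e.
  have h2 := Measure.variation_withDensityᵥ hint
  rw [h, ← SignedMeasure.totalVariation_eq_variation] at h2
  have h3 : σ.totalVariation.withDensity (fun _ => 1) =
      σ.totalVariation.withDensity (fun x => ‖σ.rnDeriv σ.totalVariation x‖ₑ) := by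
    rw [← h2]; simp
  rw [withDensity_eq_iff_of_sigmaFinite (by fun_prop)
    (SignedMeasure.measurable_rnDeriv _ _).enorm.aemeasurable] at h3
  filter_upwards [h3] with x hx
  rw [polarDensity, ← Real.norm_eq_abs, ← toReal_enorm, ← hx]
  simp

variable {m : Measure ℝ} [IsFiniteMeasure m]

/-- Puts the derivative of the test function into the form "measure plus Lebesgue density"; when `m`
is singular, uniqueness of the Lebesgue decomposition then identifies both parts. -/
lemma add_restrict_sub_eq_add_withDensityᵥ (I B : Set ℝ) (hI : MeasurableSet I)
    (hB : MeasurableSet B) (hIf : volume I ≠ ⊤) (r : NNReal)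
    [IsFiniteMeasure (m + volume.restrict (B ∩ I))] [IsFiniteMeasure (r • volume.restrict I)] :
    (m + volume.restrict (B ∩ I)).toSignedMeasure - (r • volume.restrict I).toSignedMeasure =
      m.toSignedMeasure + volume.withDensityᵥ
        (fun x => (B ∩ I).indicator (fun _ => (1 : ℝ)) x - I.indicator (fun _ => (r : ℝ)) x) := by
  have hBf : volume (B ∩ I) ≠ ⊤ := measure_ne_top_of_subset inter_subset_right hIf
  have i1 : Integrable ((B ∩ I).indicator (fun _ => (1 : ℝ))) :=
    (integrable_indicator_iff (hB.inter hI)).2 (integrableOn_const hBf)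
  have i2 : Integrable (I.indicator (fun _ => (r : ℝ))) :=
    (integrable_indicator_iff hI).2 (integrableOn_const hIf)
  ext s hs
  have hf1 : volume (s ∩ (B ∩ I)) ≠ ⊤ := measure_ne_top_of_subset inter_subset_right hBf
  rw [_root_.sub_apply, _root_.add_apply, withDensityᵥ_sub' i1 i2, _root_.sub_apply,
    withDensityᵥ_apply i1 hs, withDensityᵥ_apply i2 hs, setIntegral_indicator (hB.inter hI),
    setIntegral_indicator hI]
  simp only [Measure.toSignedMeasure_apply_measurable hs]
  rw [measureReal_def, Measure.add_apply, Measure.restrict_apply hs,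
    ENNReal.toReal_add (measure_ne_top _ _) hf1]
  simp [measureReal_def, Measure.restrict_apply hs, mul_comm, add_sub_assoc]

lemma singPart_toSignedMeasure_add_withDensityᵥ (hm : m ⟂ₘ volume) (f : ℝ → ℝ) :
    singPart (m.toSignedMeasure + volume.withDensityᵥ f) = m.toSignedMeasure := by
  refine (SignedMeasure.eq_singularPart _ f ?_ rfl).symm
  rw [SignedMeasure.mutuallySingular_ennreal_iff, totalVariation_toSignedMeasure,
    VectorMeasure.ennrealToMeasure_toENNRealVectorMeasure]
  exact hm

lemma acDensity_toSignedMeasure_add_withDensityᵥ (hm : m ⟂ₘ volume) {f : ℝ → ℝ}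
    (hf : Integrable f) :
    acDensity (m.toSignedMeasure + volume.withDensityᵥ f) =ᵐ[volume] f := by
  refine (SignedMeasure.eq_rnDeriv m.toSignedMeasure f hf ?_ rfl).symm
  rw [SignedMeasure.mutuallySingular_ennreal_iff, totalVariation_toSignedMeasure,
    VectorMeasure.ennrealToMeasure_toENNRealVectorMeasure]
  exact hm

end SingularPart

/-! ### The tested equation, the flux, and absence of a singular part -/

section Solution

variable {a b : ℝ} {f : ℝ → ℝ → ℝ} {u : ℝ → ℝ}

lemma abs_div_sqrt_lt_one (t : ℝ) : |t / √(1 + t ^ 2)| < 1 := by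
  have h : 0 < √(1 + t ^ 2) := by positivity
  rw [abs_div, abs_of_pos h, div_lt_one h]
  exact Real.lt_sqrt_of_sq_lt (by rw [sq_abs]; linarith)

lemma measurable_flux (ν : SignedMeasure ℝ) :
    Measurable fun x => acDensity ν x / √(1 + acDensity ν x ^ 2) := by
  have : Measurable (acDensity ν) := SignedMeasure.measurable_rnDeriv _ _
  fun_prop

lemma continuousOn_integral_right (hab : a < b) {g : ℝ → ℝ} (hg : IntegrableOn g (Ioo a b)) :
    ContinuousOn (fun x => ∫ t in x..b, g t) (Icc a b) := by
  have hg' : IntegrableOn g (Icc a b) := (integrableOn_Icc_iff_integrableOn_Ioo (by simp) (by simp)).2 hg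
  have := (intervalIntegral.continuousOn_primitive_interval' (μ := volume) (a := b)
    (f := g) (b₁ := a) (b₂ := b) ((intervalIntegrable_iff_integrableOn_Icc_of_le hab.le).2 hg')
    right_mem_uIcc).neg
  rw [uIcc_of_le hab.le] at this
  refine this.congr fun x _ => ?_
  simp [intervalIntegral.integral_symm b x]

lemma integrable_of_continuousOn_Icc {m : Measure ℝ} [IsFiniteMeasure m]
    (hm : m (Ioo a b)ᶜ = 0) {h : ℝ → ℝ} (hh : ContinuousOn h (Icc a b)) : Integrable h m := by
  have hr : m.restrict (Icc a b) = m := by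
    refine Measure.restrict_eq_self_of_ae_mem ?_
    filter_upwards [ae_mem_Ioo_of_compl_null hm] with t ht using Ioo_subset_Icc_self ht
  rw [← hr]
  exact hh.integrableOn_compact isCompact_Icc

/-- The equation tested with the function of bounded variation whose derivative is
`|Dˢu|` on `A` plus Lebesgue measure on `B`, minus a multiple of Lebesgue measure. -/
lemma IsBVSolution.test_identity (hab : a < b) {Du : SignedMeasure ℝ}
    (hDu : IsDistribDeriv a b u Du) (hg : IntegrableOn (fun x => f x (u x)) (Ioo a b))
    (htest : ∀ (φ : ℝ → ℝ) (Dφ : SignedMeasure ℝ),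
      IntegrableOn φ (Ioo a b) → IsDistribDeriv a b φ Dφ →
      (singPart Dφ).totalVariation ≪ (singPart Du).totalVariation →
      HasRightTrace φ a 0 → HasLeftTrace φ b 0 →
      (∫ x in Ioo a b, acDensity Du x * acDensity Dφ x / √(1 + acDensity Du x ^ 2))
        + (singPart Dφ).integral (fun x => polarDensity (singPart Du) x)
            (ContinuousLinearMap.lsmul ℝ ℝ)
        = ∫ x in Ioo a b, f x (u x) * φ x) :
    ∃ k : ℝ, ∀ A B : Set ℝ, MeasurableSet A → MeasurableSet B →
      (∫ x in B ∩ Ioo a b, (acDensity Du x / √(1 + acDensity Du x ^ 2)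
          - (k + ∫ t in x..b, f t (u t)))) +
        ∫ x in A, (polarDensity (singPart Du) x - (k + ∫ t in x..b, f t (u t)))
          ∂(singPart Du).totalVariation = 0 := by
  set m := (singPart Du).totalVariation with hm
  set T : ℝ → ℝ := fun x => acDensity Du x / √(1 + acDensity Du x ^ 2) with hT
  set Γ : ℝ → ℝ := fun x => ∫ t in x..b, f t (u t) with hΓ
  set P : ℝ → ℝ := fun x => polarDensity (singPart Du) x with hP
  have hmI : m (Ioo a b)ᶜ = 0 :=
    le_antisymm ((singPart_totalVariation_le Du _).trans hDu.carried.le) bot_le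
  have hmv : m ⟂ₘ volume := singPart_totalVariation_mutuallySingular Du
  have hΓc : ContinuousOn Γ (Icc a b) := continuousOn_integral_right hab hg
  have hTi : IntegrableOn T (Ioo a b) :=
    Measure.integrableOn_of_bounded (M := 1) (by simp) (measurable_flux Du).aestronglyMeasurable
      (ae_of_all _ fun x => (abs_div_sqrt_lt_one _).le)
  have hΓi : IntegrableOn Γ (Ioo a b) :=
    (hΓc.integrableOn_compact isCompact_Icc).mono_set Ioo_subset_Icc_self
  have hPi : Integrable P m := SignedMeasure.integrable_rnDeriv _ _
  have hΓm : Integrable Γ m := integrable_of_continuousOn_Icc hmI hΓc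
  have hba : 0 < b - a := sub_pos.2 hab
  -- The only possible constant: `k` is the mean of `T - Γ`, as the case `A = ∅`, `B = (a, b)`
  -- forces.
  refine ⟨((∫ x in Ioo a b, T x) - ∫ x in Ioo a b, Γ x) / (b - a), fun A B hA hB => ?_⟩
  set k := ((∫ x in Ioo a b, T x) - ∫ x in Ioo a b, Γ x) / (b - a) with hk
  set W := volume.restrict (B ∩ Ioo a b) with hW
  have hWV : W ≤ volume.restrict (Ioo a b) := Measure.restrict_mono inter_subset_right le_rfl
  have : IsFiniteMeasure W := isFiniteMeasure_of_le _ hWV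
  set K : ℝ := m.real A + W.real univ with hK
  have hK0 : 0 ≤ K := by positivity
  -- Spreading the mass `K` evenly over `(a, b)` makes the total mass of `Dφ` zero, hence `φ(b⁻) =
  -- 0`.
  let r : NNReal := ⟨K / (b - a), by positivity⟩
  have hrc : (r : ℝ) = K / (b - a) := rfl
  have hmA : m.restrict A ⟂ₘ volume := hmv.mono Measure.restrict_le_self le_rfl
  have h₁ : (m.restrict A + W) (Ioo a b)ᶜ = 0 := by
    rw [Measure.add_apply, add_eq_zero]
    refine ⟨le_antisymm ((Measure.restrict_le_self _).trans hmI.le) bot_le,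
      le_antisymm ((hWV _).trans ?_) bot_le⟩
    rw [Measure.restrict_apply measurableSet_Ioo.compl]; simp
  have h₂ : (r • volume.restrict (Ioo a b)) (Ioo a b)ᶜ = 0 := by
    rw [Measure.smul_apply, Measure.restrict_apply measurableSet_Ioo.compl]; simp
  have hmass : (m.restrict A + W).real univ = (r • volume.restrict (Ioo a b)).real univ := by
    rw [measureReal_add_apply]
    simp only [measureReal_restrict_apply_univ, measureReal_nnreal_smul_apply, hrc]
    rw [Real.volume_real_Ioo_of_le hab.le, div_mul_cancel₀ _ hba.ne', hK]
  have hdec := add_restrict_sub_eq_add_withDensityᵥ (m := m.restrict A) (Ioo a b) B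
    measurableSet_Ioo hB (by simp) r
  change (m.restrict A + W).toSignedMeasure - (r • volume.restrict (Ioo a b)).toSignedMeasure = _ at hdec
  set D := fun x => (B ∩ Ioo a b).indicator (fun _ => (1 : ℝ)) x
    - (Ioo a b).indicator (fun _ => (r : ℝ)) x with hD
  have hDi : Integrable D :=
    ((integrable_indicator_iff (hB.inter measurableSet_Ioo)).2
      (integrableOn_const (measure_ne_top_of_subset inter_subset_right (by simp)))).sub
      ((integrable_indicator_iff measurableSet_Ioo).2 (integrableOn_const (by simp)))
  have hs := singPart_toSignedMeasure_add_withDensityᵥ hmA D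
  have hac := acDensity_toSignedMeasure_add_withDensityᵥ hmA hDi
  rw [← hdec] at hs hac
  have key := htest _ _ integrableOn_primitive_sub (isDistribDeriv_primitive_sub h₁ h₂)
    (by rw [hs, totalVariation_toSignedMeasure]; exact Measure.absolutelyContinuous_of_le
          Measure.restrict_le_self)
    (hasRightTrace_primitive_sub h₁ h₂) (hasLeftTrace_primitive_sub h₁ h₂ hmass)
  have hTW : Integrable T W := Integrable.mono_measure hTi hWV
  have hΓW : Integrable Γ W := Integrable.mono_measure hΓi hWV
  rw [hs, integral_lsmul_toSignedMeasure, integral_mul_primitive_sub h₁ h₂ hg] at key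
  change _ = ∫ t, Γ t ∂(m.restrict A + W) - ∫ t, Γ t ∂(r • volume.restrict (Ioo a b)) at key
  rw [integral_add_measure hΓm.restrict hΓW, integral_smul_nnreal_measure] at key
  -- On `(a, b)` the absolutely continuous density of `Dφ` is the indicator of `B` minus `r`.
  have e1 : ∫ x in Ioo a b, acDensity Du x * acDensity ((m.restrict A + W).toSignedMeasure
      - (r • volume.restrict (Ioo a b)).toSignedMeasure) x / √(1 + acDensity Du x ^ 2)
      = ∫ x, T x ∂W - r * ∫ x in Ioo a b, T x := by
    have : ∀ᵐ x ∂(volume.restrict (Ioo a b)), acDensity Du x * acDensity ((m.restrict A + W).toSignedMeasure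
      - (r • volume.restrict (Ioo a b)).toSignedMeasure) x / √(1 + acDensity Du x ^ 2) = B.indicator T x - r * T x := by
      filter_upwards [ae_restrict_of_ae hac, ae_restrict_mem measurableSet_Ioo] with x hx hxI
      rw [hx]
      by_cases hxB : x ∈ B
      · simp only [hD, hT, indicator, mem_inter_iff, hxI, hxB, and_true, if_true]
        ring
      · simp only [hD, hT, indicator, mem_inter_iff, hxI, hxB, and_true, if_true, if_false]
        ring
    rw [integral_congr_ae this, integral_sub (hTi.indicator hB) (hTi.const_mul _),
      integral_indicator hB, Measure.restrict_restrict hB, integral_const_mul]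
  rw [e1] at key
  change ∫ x, (T x - (k + Γ x)) ∂W + ∫ x in A, (P x - (k + Γ x)) ∂m = 0
  have hlin : ∀ (n : Measure ℝ) [IsFiniteMeasure n] (h : ℝ → ℝ), Integrable h n →
      Integrable Γ n → ∫ x, (h x - (k + Γ x)) ∂n = ∫ x, h x ∂n - (n.real univ * k + ∫ x, Γ x ∂n) :=
    fun n _ h hh hn => by
      rw [integral_sub hh (by exact (integrable_const k).add hn),
        integral_add (integrable_const k) hn, integral_const, smul_eq_mul]
  rw [hlin W T hTW hΓW, hlin (m.restrict A) P hPi.restrict hΓm.restrict,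
    measureReal_restrict_apply_univ (μ := m)]
  have hkr : (r : ℝ) * ((∫ x in Ioo a b, T x) - ∫ x in Ioo a b, Γ x) = K * k := by
    rw [hrc, hk]; ring
  simp only [NNReal.smul_def, smul_eq_mul] at key
  rw [hK] at hkr
  linarith

/-- The flux of a solution is a primitive of `-f(·, u)`, and so is the sign of the jump part. -/
lemma IsBVSolution.exists_profile (hab : a < b) (hu : IsBVSolution a b f u) :
    ∃ (Du : SignedMeasure ℝ) (k : ℝ), IsDistribDeriv a b u Du ∧
      (∀ᵐ x ∂volume.restrict (Ioo a b),
        acDensity Du x / √(1 + acDensity Du x ^ 2) = k + ∫ t in x..b, f t (u t)) ∧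
      ∀ᵐ x ∂(singPart Du).totalVariation,
        polarDensity (singPart Du) x = k + ∫ t in x..b, f t (u t) := by
  obtain ⟨-, hg, Du, hDu, htest⟩ := hu
  obtain ⟨k, hk⟩ := test_identity hab hDu hg htest
  have hΓc : ContinuousOn (fun x => k + ∫ t in x..b, f t (u t)) (Icc a b) :=
    continuousOn_const.add (continuousOn_integral_right hab hg)
  have hmI : (singPart Du).totalVariation (Ioo a b)ᶜ = 0 :=
    le_antisymm ((singPart_totalVariation_le Du _).trans hDu.carried.le) bot_le
  refine ⟨Du, k, hDu, ?_, ?_⟩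
  · have hTi : IntegrableOn (fun x => acDensity Du x / √(1 + acDensity Du x ^ 2)) (Ioo a b) :=
      Measure.integrableOn_of_bounded (M := 1) (by simp)
        (measurable_flux Du).aestronglyMeasurable
        (ae_of_all _ fun x => (abs_div_sqrt_lt_one _).le)
    have hΓi := (hΓc.integrableOn_compact (μ := volume) isCompact_Icc).mono_set Ioo_subset_Icc_self
    have := (hTi.sub hΓi).ae_eq_zero_of_forall_setIntegral_eq_zero fun B hB _ => by
      have := hk ∅ B .empty hB
      rw [Measure.restrict_restrict hB]
      simpa using this
    filter_upwards [this] with x hx using sub_eq_zero.1 hx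
  · have hPi : Integrable (polarDensity (singPart Du)) (singPart Du).totalVariation :=
      SignedMeasure.integrable_rnDeriv _ _
    have := (hPi.sub (integrable_of_continuousOn_Icc hmI hΓc)).ae_eq_zero_of_forall_setIntegral_eq_zero
      fun A hA _ => by
        have := hk A ∅ hA .empty
        simpa using this
    filter_upwards [this] with x hx using sub_eq_zero.1 hx

lemma isWeakDeriv_acDensity {Du : SignedMeasure ℝ} (hDu : IsDistribDeriv a b u Du)
    (hs : (singPart Du).totalVariation = 0) : IsWeakDeriv a b u (acDensity Du) := by
  have hs0 : singPart Du = 0 := by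
    ext s hs'
    exact (singPart Du).null_of_totalVariation_zero (by rw [hs]; simp)
  have hd := SignedMeasure.singularPart_add_withDensity_rnDeriv_eq (s := Du) (μ := volume)
  change singPart Du + volume.withDensityᵥ (acDensity Du) = Du at hd
  rw [hs0, zero_add] at hd
  intro θ hθ
  rw [hDu.by_parts θ hθ]
  conv_lhs => rw [← hd]
  rw [integral_lsmul_withDensityᵥ (g := acDensity Du) hθ.smooth.continuous hθ.compact
    (SignedMeasure.integrable_rnDeriv _ _) (SignedMeasure.measurable_rnDeriv _ _),
    setIntegral_eq_integral_of_forall_compl_eq_zero]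
  intro x hx
  rw [hθ.eq_zero hx, mul_zero]

/-- If the flux has modulus less than one, the derivative has no singular part. -/
lemma IsBVSolution.exists_weakDeriv (hab : a < b) (hu : IsBVSolution a b f u)
    (hlt : ∀ k : ℝ, (∀ᵐ x ∂volume.restrict (Ioo a b), |k + ∫ t in x..b, f t (u t)| < 1) →
      ∀ x ∈ Ioo a b, |k + ∫ t in x..b, f t (u t)| < 1) :
    ∃ (α : ℝ → ℝ) (k : ℝ), IntegrableOn α (Ioo a b) ∧ IsWeakDeriv a b u α ∧
      (∀ᵐ x ∂volume.restrict (Ioo a b), α x / √(1 + α x ^ 2) = k + ∫ t in x..b, f t (u t)) ∧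
      ∀ x ∈ Ioo a b, |k + ∫ t in x..b, f t (u t)| < 1 := by
  obtain ⟨Du, k, hDu, hflux, hpol⟩ := hu.exists_profile hab
  have hmI : (singPart Du).totalVariation (Ioo a b)ᶜ = 0 :=
    le_antisymm ((singPart_totalVariation_le Du _).trans hDu.carried.le) bot_le
  -- The a.e. bound says nothing on the Lebesgue-null set carrying `|Dˢu|`; `hlt` upgrades it to
  -- every interior point.
  have hk := hlt k (by
    filter_upwards [hflux] with x hx
    rw [← hx]
    exact abs_div_sqrt_lt_one _)
  refine ⟨acDensity Du, k, (SignedMeasure.integrable_rnDeriv _ _).integrableOn,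
    isWeakDeriv_acDensity hDu ?_, hflux, hk⟩
  -- `|Dˢu|`-a.e. point would satisfy both `|p| = 1` and `|p| < 1`, so this measure is zero.
  rw [← ae_eq_bot, ← Filter.eventually_false_iff_eq_bot]
  filter_upwards [hpol, abs_polarDensity (singPart Du), ae_mem_Ioo_of_compl_null hmI]
    with x h1 h2 h3
  rw [h1] at h2
  exact (hk x h3).ne h2

end Solution

/-! ### Absolute continuity and second weak derivatives -/

section AbsolutelyContinuous

lemma absolutelyContinuousOnInterval_comp_of_lipschitzOnWith {K : NNReal} {H p : ℝ → ℝ}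
    {S : Set ℝ} {s t : ℝ} (hH : LipschitzOnWith K H S) (hp : AbsolutelyContinuousOnInterval p s t)
    (hS : MapsTo p (uIcc s t) S) : AbsolutelyContinuousOnInterval (H ∘ p) s t := by
  have h := (show Tendsto _ _ _ from hp).const_mul (K : ℝ)
  rw [mul_zero] at h
  refine squeeze_zero' (Eventually.of_forall fun E => Finset.sum_nonneg fun i _ => dist_nonneg)
    ?_ h
  filter_upwards [mem_inf_of_right (mem_principal_self _)] with E hE
  rw [Finset.mul_sum]
  exact Finset.sum_le_sum fun i hi =>
    hH.dist_le_mul _ (hS (hE.1 i hi).1) _ (hS (hE.1 i hi).2)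

lemma contDiffOn_div_sqrt_one_sub_sq {r : ℝ} (hr : r < 1) :
    ContDiffOn ℝ 1 (fun y : ℝ => y / √(1 - y ^ 2)) (Icc (-r) r) := by
  have h : ∀ y ∈ Icc (-r) r, 1 - y ^ 2 ≠ 0 := fun y hy => by
    nlinarith [hy.1, hy.2]
  refine contDiffOn_id.div (ContDiffOn.sqrt (by fun_prop) h) fun y hy => ?_
  have : 0 < 1 - y ^ 2 := by nlinarith [hy.1, hy.2]
  exact (Real.sqrt_pos.2 this).ne'

/-- The relation `1 - p² = 1 / (1 + α²)` lets the flux be inverted. -/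
lemma eq_div_sqrt_one_sub_sq {α p : ℝ} (h : α / √(1 + α ^ 2) = p) : α = p / √(1 - p ^ 2) := by
  have h1 : 0 < 1 + α ^ 2 := by positivity
  have h2 : 0 < √(1 + α ^ 2) := Real.sqrt_pos.2 h1
  have h3 : 1 - p ^ 2 = (√(1 + α ^ 2))⁻¹ ^ 2 := by
    rw [← h, div_pow, inv_pow, Real.sq_sqrt h1.le]
    field_simp
    ring
  rw [h3, Real.sqrt_sq (by positivity), ← h]
  field_simp

variable {s t : ℝ}

lemma isWeakDeriv_deriv (hst : s ≤ t) {v : ℝ → ℝ} (hv : AbsolutelyContinuousOnInterval v s t) :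
    IsWeakDeriv s t v (deriv v) := by
  intro θ hθ
  have hθac : AbsolutelyContinuousOnInterval θ s t :=
    (hθ.smooth.of_le (by simp)).contDiffOn.absolutelyContinuousOnInterval
  have := hv.integral_mul_deriv_eq_deriv_mul hθac
  rw [hθ.eq_zero (by simp), hθ.eq_zero (by simp), intervalIntegral.integral_of_le hst,
    intervalIntegral.integral_of_le hst, integral_Ioc_eq_integral_Ioo,
    integral_Ioc_eq_integral_Ioo] at this
  simpa using this

/-- Test functions on the smaller interval vanish, with their derivatives, on the rest of the larger
one. -/
lemma IsWeakDeriv.mono {a b : ℝ} {u g : ℝ → ℝ} (h : IsWeakDeriv a b u g)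
    (hst : Ioo s t ⊆ Ioo a b) : IsWeakDeriv s t u g := by
  intro θ hθ
  have h1 : ∫ x in Ioo s t, u x * deriv θ x = ∫ x in Ioo a b, u x * deriv θ x :=
    (setIntegral_eq_of_subset_of_forall_sdiff_eq_zero measurableSet_Ioo hst fun x hx => by
      rw [hθ.deriv_eq_zero hx.2, mul_zero]).symm
  have h2 : ∫ x in Ioo s t, g x * θ x = ∫ x in Ioo a b, g x * θ x :=
    (setIntegral_eq_of_subset_of_forall_sdiff_eq_zero measurableSet_Ioo hst fun x hx => by
      rw [hθ.eq_zero hx.2, mul_zero]).symm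
  rw [h1, h2]
  exact h θ (hθ.mono hst)

/-- Second order regularity on an interval where the flux stays away from `±1`. -/
lemma memW21_of_flux (hst : s ≤ t) {u α p : ℝ → ℝ} (hu : IntegrableOn u (Ioo s t))
    (hα : IntegrableOn α (Ioo s t)) (hw : IsWeakDeriv s t u α)
    (hp : AbsolutelyContinuousOnInterval p s t)
    (hflux : ∀ᵐ x ∂volume.restrict (Ioo s t), α x / √(1 + α x ^ 2) = p x)
    (hlt : ∀ x ∈ Icc s t, |p x| < 1) : MemW21 s t u := by
  have hpc := hp.continuousOn
  rw [uIcc_of_le hst] at hpc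
  -- By compactness `|p| ≤ |p x₀| < 1`, and `y / √(1 - y²)` is Lipschitz on `[-|p x₀|, |p x₀|]`;
  -- composing with `p` preserves absolute continuity.
  obtain ⟨x₀, hx₀, hmax⟩ := isCompact_Icc.exists_isMaxOn (nonempty_Icc.2 hst) hpc.abs
  obtain ⟨K, hK⟩ := (contDiffOn_div_sqrt_one_sub_sq (hlt x₀ hx₀)).exists_lipschitzOnWith
    (by decide) (convex_Icc _ _) isCompact_Icc
  have hv := absolutelyContinuousOnInterval_comp_of_lipschitzOnWith hK hp
    (by rw [uIcc_of_le hst]; exact fun x hx => abs_le.1 (hmax hx))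
  refine ⟨hu, α, deriv ((fun y : ℝ => y / √(1 - y ^ 2)) ∘ p), hα, hw,
    (intervalIntegrable_iff_integrableOn_Ioo_of_le hst).1 hv.intervalIntegrable_deriv,
    fun θ hθ => ?_⟩
  rw [← isWeakDeriv_deriv hst hv θ hθ]
  refine integral_congr_ae ?_
  filter_upwards [hflux] with x hx
  rw [eq_div_sqrt_one_sub_sq hx]
  rfl

end AbsolutelyContinuous

/-! ### Integrability of the derivative against divergence of `∫ dx / √M` -/

section Endpoint

/-- If the flux tends to `±1` so fast that `∫ dx / √M = ∞` with `1 - |p| ≤ M`, then the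
derivative is not integrable. -/
lemma lintegral_one_div_sqrt_ne_top {s t : ℝ} {α p M : ℝ → ℝ}
    (hα : IntegrableOn α (Ioo s t))
    (hflux : ∀ᵐ x ∂volume.restrict (Ioo s t), α x / √(1 + α x ^ 2) = p x)
    (hM : ∀ x ∈ Ioo s t, 1 - |p x| ≤ M x) :
    ∫⁻ x in Ioo s t, ENNReal.ofReal (1 / √(M x)) ≠ ⊤ := by
  have hi : IntegrableOn (fun x => √2 * (1 + |α x|)) (Ioo s t) :=
    ((integrableOn_const (by simp)).add hα.abs).const_mul _
  refine ne_top_of_le_ne_top hi.lintegral_lt_top.ne (lintegral_mono_ae ?_)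
  filter_upwards [hflux, ae_restrict_mem measurableSet_Ioo] with x hx hxI
  refine ENNReal.ofReal_le_ofReal ?_
  have hp1 : |p x| < 1 := hx ▸ abs_div_sqrt_lt_one _
  have h1 : 0 < 1 + α x ^ 2 := by positivity
  have h3 : (1 + α x ^ 2) * (1 - p x ^ 2) = 1 := by
    rw [← hx, div_pow, Real.sq_sqrt h1.le]
    field_simp
    ring
  -- Uses `(1 + α²)(1 - p²) = 1` and `1 - p² = (1 - |p|)(1 + |p|) ≤ 2M`. Its square root is the
  -- bound `1 / √M ≤ √2 (1 + |α|)`.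
  have h4 : 1 ≤ (1 + |α x|) ^ 2 * (2 * M x) := by
    rw [← sq_abs (α x), ← sq_abs (p x)] at h3
    have hM' := hM x hxI
    have hα0 := abs_nonneg (α x)
    have hp0 := abs_nonneg (p x)
    calc (1 : ℝ) = (1 + |α x| ^ 2) * (1 - |p x| ^ 2) := h3.symm
      _ ≤ (1 + |α x|) ^ 2 * (2 * M x) := by
        refine mul_le_mul (by nlinarith) (by nlinarith) (by nlinarith) (by positivity)
  have hMpos : 0 < M x := (sub_pos.2 hp1).trans_le (hM x hxI)
  rw [div_le_iff₀ (Real.sqrt_pos.2 hMpos)]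
  calc (1 : ℝ) ≤ √((1 + |α x|) ^ 2 * (2 * M x)) := Real.one_le_sqrt.2 h4
    _ = √2 * (1 + |α x|) * √(M x) := by
        rw [Real.sqrt_mul (by positivity), Real.sqrt_sq (by positivity),
          Real.sqrt_mul (by norm_num)]
        ring

end Endpoint

/-! ### Bounds on the flux inside the interval and at its endpoints -/

section Flux

variable {a b k : ℝ} {g : ℝ → ℝ}

lemma intervalIntegrable_of_integrableOn_Ioo (hg : IntegrableOn g (Ioo a b)) {x y : ℝ}
    (hx : x ∈ Icc a b) (hy : y ∈ Icc a b) : IntervalIntegrable g volume x y := by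
  have h : IntervalIntegrable g volume a b :=
    (intervalIntegrable_iff_integrableOn_Ioo_of_le (hx.1.trans hx.2)).2 hg
  refine h.mono_set ?_
  rw [uIcc_of_le (hx.1.trans hx.2)]
  exact uIcc_subset_Icc hx hy

lemma antitoneOn_integral_right (hg : IntegrableOn g (Ioo a b))
    (h0 : ∀ᵐ x, x ∈ Ioo a b → 0 ≤ g x) : AntitoneOn (fun x => ∫ t in x..b, g t) (Icc a b) := by
  intro x hx y hy hxy
  have hb : b ∈ Icc a b := ⟨hx.1.trans hx.2, le_rfl⟩
  have hadd := intervalIntegral.integral_add_adjacent_intervals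
    (intervalIntegrable_of_integrableOn_Ioo hg hx hy)
    (intervalIntegrable_of_integrableOn_Ioo hg hy hb)
  have hnn : 0 ≤ ∫ t in x..y, g t := by
    rw [intervalIntegral.integral_of_le hxy, integral_Ioc_eq_integral_Ioo]
    refine setIntegral_nonneg_of_ae_restrict ?_
    filter_upwards [ae_restrict_of_ae h0, ae_restrict_mem measurableSet_Ioo] with t ht htI
    exact ht ⟨hx.1.trans_lt htI.1, htI.2.trans_le hy.2⟩
  change ∫ t in y..b, g t ≤ ∫ t in x..b, g t
  linarith

/-- On each side of `x` there is a point where `|p| < 1`; monotonicity squeezes `p x` between the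
two values. -/
lemma abs_lt_one_of_antitoneOn {p : ℝ → ℝ} (hp : AntitoneOn p (Icc a b))
    (hlt : ∀ᵐ x ∂volume.restrict (Ioo a b), |p x| < 1) {x : ℝ} (hx : x ∈ Ioo a b) :
    |p x| < 1 := by
  have hex : ∀ c d, c < d → Ioo c d ⊆ Ioo a b → ∃ y ∈ Ioo c d, |p y| < 1 := by
    intro c d hcd hsub
    have : NeBot (ae (volume.restrict (Ioo c d))) := by
      rw [ae_neBot, Ne, Measure.restrict_eq_zero]
      simpa using hcd
    obtain ⟨y, hy, hyI⟩ := ((ae_restrict_of_ae_restrict_of_subset hsub hlt).and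
      (ae_restrict_mem measurableSet_Ioo)).exists
    exact ⟨y, hyI, hy⟩
  obtain ⟨y, hy, hpy⟩ := hex a x hx.1 (Ioo_subset_Ioo_right hx.2.le)
  obtain ⟨z, hz, hpz⟩ := hex x b hx.2 (Ioo_subset_Ioo_left hx.1.le)
  have hxI := Ioo_subset_Icc_self hx
  have h1 := hp ⟨hy.1.le, hy.2.le.trans hx.2.le⟩ hxI hy.2.le
  have h2 := hp hxI ⟨hx.1.le.trans hz.1.le, hz.2.le⟩ hz.1.le
  exact abs_lt.2 ⟨(abs_lt.1 hpz).1.trans_le h2, h1.trans_lt (abs_lt.1 hpy).2⟩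

lemma abs_flux_lt_one (hg : IntegrableOn g (Ioo a b))
    (hsign : (∀ᵐ x, x ∈ Ioo a b → 0 ≤ g x) ∨ ∀ᵐ x, x ∈ Ioo a b → g x ≤ 0)
    (hlt : ∀ᵐ x ∂volume.restrict (Ioo a b), |k + ∫ t in x..b, g t| < 1) :
    ∀ x ∈ Ioo a b, |k + ∫ t in x..b, g t| < 1 := by
  intro x hx
  rcases hsign with h | h
  · exact abs_lt_one_of_antitoneOn (p := fun x => k + ∫ t in x..b, g t)
      ((antitoneOn_integral_right hg h).const_add k) hlt hx
  · have hanti := antitoneOn_integral_right (g := fun t => -g t) hg.neg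
      (h.mono fun x hx hxI => neg_nonneg.2 (hx hxI))
    have habs : ∀ y, |-k + ∫ t in y..b, -g t| = |k + ∫ t in y..b, g t| := fun y => by
      rw [intervalIntegral.integral_neg, ← neg_add, abs_neg]
    rw [← habs]
    exact abs_lt_one_of_antitoneOn (p := fun x => -k + ∫ t in x..b, -g t)
      (hanti.const_add (-k)) (by simpa only [habs] using hlt) hx

lemma absolutelyContinuousOnInterval_flux (hab : a ≤ b) (hg : IntegrableOn g (Ioo a b)) :
    AbsolutelyContinuousOnInterval (fun x => k + ∫ t in x..b, g t) a b := by
  have h := ((intervalIntegrable_iff_integrableOn_Ioo_of_le hab).2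
    hg).absolutelyContinuousOnInterval_intervalIntegral right_mem_uIcc
  have hc : AbsolutelyContinuousOnInterval (fun _ : ℝ => k) a b :=
    contDiffOn_const.absolutelyContinuousOnInterval
  rw [show (fun x => k + ∫ t in x..b, g t) = (fun _ => k) - fun x => ∫ t in b..x, g t from
    funext fun x => by rw [Pi.sub_apply, intervalIntegral.integral_symm b x, sub_eq_add_neg]]
  exact hc.sub h

variable {α μ : ℝ → ℝ} {δ : ℝ}

/-- Otherwise `1 - |p x| ≤ |p a| - |p x| ≤ |∫ t in a..x, g t| ≤ M x`, and integrability of `α`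
contradicts the divergence. -/
lemma abs_flux_left_lt_one (hg : IntegrableOn g (Ioo a b)) (hα : IntegrableOn α (Ioo a b))
    (hflux : ∀ᵐ x ∂volume.restrict (Ioo a b), α x / √(1 + α x ^ 2) = k + ∫ t in x..b, g t)
    (hδ : 0 < δ) (hδb : a + δ ≤ b) (hμ : IntegrableOn μ (Ioo a (a + δ)))
    (hgμ : ∀ᵐ x, x ∈ Ioo a (a + δ) → |g x| ≤ μ x)
    (hdiv : ∫⁻ x in Ioo a (a + δ), ENNReal.ofReal (1 / √(∫ t in a..x, μ t)) = ⊤) :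
    |k + ∫ t in a..b, g t| < 1 := by
  by_contra! hge
  have hsub : Ioo a (a + δ) ⊆ Ioo a b := Ioo_subset_Ioo_right hδb
  refine lintegral_one_div_sqrt_ne_top (hα.mono_set hsub)
    (ae_restrict_of_ae_restrict_of_subset hsub hflux) (fun x hx => ?_) hdiv
  have hxI : x ∈ Icc a b := Ioo_subset_Icc_self (hsub hx)
  have hab : a ≤ b := hxI.1.trans hxI.2
  have hadd := intervalIntegral.integral_add_adjacent_intervals
    (intervalIntegrable_of_integrableOn_Ioo hg ⟨le_rfl, hab⟩ hxI)
    (intervalIntegrable_of_integrableOn_Ioo hg hxI ⟨hab, le_rfl⟩)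
  have hle : ‖∫ t in a..x, g t‖ ≤ ∫ t in a..x, μ t := by
    refine intervalIntegral.norm_integral_le_of_norm_le hx.1.le ?_
      (intervalIntegrable_of_integrableOn_Ioo hμ ⟨le_rfl, by linarith⟩ ⟨hx.1.le, hx.2.le⟩)
    filter_upwards [hgμ] with t ht htI using ht ⟨htI.1, htI.2.trans_lt hx.2⟩
  rw [Real.norm_eq_abs] at hle
  have htri := abs_add_le (∫ t in a..x, g t) (k + ∫ t in x..b, g t)
  rw [← hadd, show k + ((∫ t in a..x, g t) + ∫ t in x..b, g t)
    = (∫ t in a..x, g t) + (k + ∫ t in x..b, g t) by ring] at hge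
  linarith

/-- The mirror argument at `b`, where the flux takes the value `k`. -/
lemma abs_flux_right_lt_one (hα : IntegrableOn α (Ioo a b))
    (hflux : ∀ᵐ x ∂volume.restrict (Ioo a b), α x / √(1 + α x ^ 2) = k + ∫ t in x..b, g t)
    (hδ : 0 < δ) (hδa : a ≤ b - δ) (hμ : IntegrableOn μ (Ioo (b - δ) b))
    (hgμ : ∀ᵐ x, x ∈ Ioo (b - δ) b → |g x| ≤ μ x)
    (hdiv : ∫⁻ x in Ioo (b - δ) b, ENNReal.ofReal (1 / √(∫ t in x..b, μ t)) = ⊤) :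
    |k| < 1 := by
  by_contra! hge
  have hsub : Ioo (b - δ) b ⊆ Ioo a b := Ioo_subset_Ioo_left hδa
  refine lintegral_one_div_sqrt_ne_top (hα.mono_set hsub)
    (ae_restrict_of_ae_restrict_of_subset hsub hflux) (fun x hx => ?_) hdiv
  have hle : ‖∫ t in x..b, g t‖ ≤ ∫ t in x..b, μ t := by
    refine intervalIntegral.norm_integral_le_of_norm_le hx.2.le ?_
      (intervalIntegrable_of_integrableOn_Ioo hμ ⟨hx.1.le, hx.2.le⟩ ⟨by linarith, le_rfl⟩)
    -- The interval integral runs over `Ioc x b`, while the bound on `g` is only available on the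
    -- open interval.
    have hb : ∀ᵐ t : ℝ, t ≠ b := Measure.ae_ne volume b
    filter_upwards [hgμ, hb] with t ht htb htI
      using ht ⟨hx.1.trans htI.1, lt_of_le_of_ne htI.2 htb⟩
  rw [Real.norm_eq_abs] at hle
  have htri := abs_sub (k + ∫ t in x..b, g t) (∫ t in x..b, g t)
  rw [add_sub_cancel_right] at htri
  linarith

end Flux

/-! ### Regularity up to one endpoint -/

section Regularity

variable {a b : ℝ} {f : ℝ → ℝ → ℝ} {u : ℝ → ℝ} {μ : ℝ → ℝ} {δ : ℝ}

lemma IsBVSolution.regular_left (hab : a < b) (hu : IsBVSolution a b f u)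
    (hsign : (∀ᵐ x, x ∈ Ioo a b → 0 ≤ f x (u x)) ∨ ∀ᵐ x, x ∈ Ioo a b → f x (u x) ≤ 0)
    (hδ : 0 < δ) (hδb : a + δ ≤ b) (hμ : IntegrableOn μ (Ioo a (a + δ)))
    (hgμ : ∀ᵐ x, x ∈ Ioo a (a + δ) → |f x (u x)| ≤ μ x)
    (hdiv : ∫⁻ x in Ioo a (a + δ), ENNReal.ofReal (1 / √(∫ t in a..x, μ t)) = ⊤) :
    MemW21LocIco a b u ∧ MemW11 a b u := by
  have hg := hu.2.1
  obtain ⟨α, k, hα, hw, hflux, hlt⟩ := hu.exists_weakDeriv hab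
    fun k hk => abs_flux_lt_one hg hsign hk
  have hend := abs_flux_left_lt_one hg hα hflux hδ hδb hμ hgμ hdiv
  refine ⟨fun c hc => ?_, hu.1, α, hα, hw⟩
  have hsub : Ioo a c ⊆ Ioo a b := Ioo_subset_Ioo_right hc.2.le
  refine memW21_of_flux hc.1.le (hu.1.mono_set hsub) (hα.mono_set hsub) (hw.mono hsub)
    ((absolutelyContinuousOnInterval_flux (k := k) hab.le hg).mono
      (uIcc_subset_uIcc_left (by rw [uIcc_of_le hab.le]; exact Ioo_subset_Icc_self hc)))
    (ae_restrict_of_ae_restrict_of_subset hsub hflux) fun x hx => ?_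
  -- At `a` itself the strict bound comes from the divergence condition, at interior points from
  -- monotonicity of the flux.
  rcases eq_or_lt_of_le hx.1 with rfl | hx'
  · exact hend
  · exact hlt x ⟨hx', hx.2.trans_lt hc.2⟩

lemma IsBVSolution.regular_right (hab : a < b) (hu : IsBVSolution a b f u)
    (hsign : (∀ᵐ x, x ∈ Ioo a b → 0 ≤ f x (u x)) ∨ ∀ᵐ x, x ∈ Ioo a b → f x (u x) ≤ 0)
    (hδ : 0 < δ) (hδa : a ≤ b - δ) (hμ : IntegrableOn μ (Ioo (b - δ) b))
    (hgμ : ∀ᵐ x, x ∈ Ioo (b - δ) b → |f x (u x)| ≤ μ x)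
    (hdiv : ∫⁻ x in Ioo (b - δ) b, ENNReal.ofReal (1 / √(∫ t in x..b, μ t)) = ⊤) :
    MemW21LocIoc a b u ∧ MemW11 a b u := by
  have hg := hu.2.1
  obtain ⟨α, k, hα, hw, hflux, hlt⟩ := hu.exists_weakDeriv hab
    fun k hk => abs_flux_lt_one hg hsign hk
  have hend := abs_flux_right_lt_one hα hflux hδ hδa hμ hgμ hdiv
  refine ⟨fun c hc => ?_, hu.1, α, hα, hw⟩
  have hsub : Ioo c b ⊆ Ioo a b := Ioo_subset_Ioo_left hc.1.le
  refine memW21_of_flux hc.2.le (hu.1.mono_set hsub) (hα.mono_set hsub) (hw.mono hsub)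
    ((absolutelyContinuousOnInterval_flux (k := k) hab.le hg).mono
      (uIcc_subset_uIcc_right (by rw [uIcc_of_le hab.le]; exact Ioo_subset_Icc_self hc)))
    (ae_restrict_of_ae_restrict_of_subset hsub hflux) fun x hx => ?_
  rcases eq_or_lt_of_le hx.2 with rfl | hx'
  · simpa using hend
  · exact hlt x ⟨hc.1.trans_le hx.1, hx'⟩

end Regularity

end Curvature

theorem theorem3p2 (a b : ℝ) (hab : a < b) (f : ℝ → ℝ → ℝ) (u : ℝ → ℝ)
    (hu : Curvature.IsBVSolution a b f u) :
    -- nonnegative right-hand side, left endpoint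
    ((∀ᵐ x, x ∈ Ioo a b → 0 ≤ f x (u x)) →
      (∃ (δ : ℝ) (μ : ℝ → ℝ), 0 < δ ∧ a + δ ≤ b ∧ IntegrableOn μ (Ioo a (a + δ)) ∧
        (∀ᵐ x, x ∈ Ioo a (a + δ) → f x (u x) ≤ μ x) ∧
        (∀ x ∈ Ioc a (a + δ), 0 < ∫ t in a..x, μ t) ∧
        ∫⁻ x in Ioo a (a + δ), ENNReal.ofReal (1 / √(∫ t in a..x, μ t)) = ⊤) →
      Curvature.MemW21LocIco a b u ∧ Curvature.MemW11 a b u) ∧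
    -- nonnegative right-hand side, right endpoint
    ((∀ᵐ x, x ∈ Ioo a b → 0 ≤ f x (u x)) →
      (∃ (δ : ℝ) (μ : ℝ → ℝ), 0 < δ ∧ a ≤ b - δ ∧ IntegrableOn μ (Ioo (b - δ) b) ∧
        (∀ᵐ x, x ∈ Ioo (b - δ) b → f x (u x) ≤ μ x) ∧
        (∀ x ∈ Ico (b - δ) b, 0 < ∫ t in x..b, μ t) ∧
        ∫⁻ x in Ioo (b - δ) b, ENNReal.ofReal (1 / √(∫ t in x..b, μ t)) = ⊤) →
      Curvature.MemW21LocIoc a b u ∧ Curvature.MemW11 a b u) ∧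
    -- nonpositive right-hand side, left endpoint
    ((∀ᵐ x, x ∈ Ioo a b → f x (u x) ≤ 0) →
      (∃ (δ : ℝ) (ν : ℝ → ℝ), 0 < δ ∧ a + δ ≤ b ∧ IntegrableOn ν (Ioo a (a + δ)) ∧
        (∀ᵐ x, x ∈ Ioo a (a + δ) → ν x ≤ f x (u x)) ∧
        (∀ x ∈ Ioc a (a + δ), (∫ t in a..x, ν t) < 0) ∧
        ∫⁻ x in Ioo a (a + δ), ENNReal.ofReal (1 / √(-∫ t in a..x, ν t)) = ⊤) →
      Curvature.MemW21LocIco a b u ∧ Curvature.MemW11 a b u) ∧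
    -- nonpositive right-hand side, right endpoint
    ((∀ᵐ x, x ∈ Ioo a b → f x (u x) ≤ 0) →
      (∃ (δ : ℝ) (ν : ℝ → ℝ), 0 < δ ∧ a ≤ b - δ ∧ IntegrableOn ν (Ioo (b - δ) b) ∧
        (∀ᵐ x, x ∈ Ioo (b - δ) b → ν x ≤ f x (u x)) ∧
        (∀ x ∈ Ico (b - δ) b, (∫ t in x..b, ν t) < 0) ∧
        ∫⁻ x in Ioo (b - δ) b, ENNReal.ofReal (1 / √(-∫ t in x..b, ν t)) = ⊤) →
      Curvature.MemW21LocIoc a b u ∧ Curvature.MemW11 a b u) := by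
  refine ⟨?_, ?_, ?_, ?_⟩
  · rintro h0 ⟨δ, μ, hδ, hδb, hμ, hfμ, -, hdiv⟩
    refine hu.regular_left hab (.inl h0) hδ hδb hμ ?_ hdiv
    filter_upwards [h0, hfμ] with x hx hx' hxI
    rw [abs_of_nonneg (hx ⟨hxI.1, hxI.2.trans_le hδb⟩)]
    exact hx' hxI
  · rintro h0 ⟨δ, μ, hδ, hδa, hμ, hfμ, -, hdiv⟩
    refine hu.regular_right hab (.inl h0) hδ hδa hμ ?_ hdiv
    filter_upwards [h0, hfμ] with x hx hx' hxI
    rw [abs_of_nonneg (hx ⟨hδa.trans_lt hxI.1, hxI.2⟩)]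
    exact hx' hxI
  · rintro h0 ⟨δ, ν, hδ, hδb, hν, hfν, -, hdiv⟩
    -- For `f(·, u) ≤ 0` the lower bound `ν` amounts to `|f(·, u)| ≤ -ν`.
    refine hu.regular_left hab (.inr h0) hδ hδb (μ := fun t => -ν t) hν.neg ?_ ?_
    · filter_upwards [h0, hfν] with x hx hx' hxI
      rw [abs_of_nonpos (hx ⟨hxI.1, hxI.2.trans_le hδb⟩)]
      exact neg_le_neg (hx' hxI)
    · simpa only [intervalIntegral.integral_neg] using hdiv
  · rintro h0 ⟨δ, ν, hδ, hδa, hν, hfν, -, hdiv⟩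
    refine hu.regular_right hab (.inr h0) hδ hδa (μ := fun t => -ν t) hν.neg ?_ ?_
    · filter_upwards [h0, hfν] with x hx hx' hxI
      rw [abs_of_nonpos (hx ⟨hδa.trans_lt hxI.1, hxI.2⟩)]
      exact neg_le_neg (hx' hxI)
    · simpa only [intervalIntegral.integral_neg] using hdiv
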